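/- Let $E$ be a (real) Banach lattice with dual Banach lattice $E^*$ (ordered by $f\le g$ iff $f(x)\le g(x)$ for all $x\ge 0$ in $E$), and let $1\le p<\infty$ be a real number. A sequence $(v_n)_n$ in $E$ or $E^*$ is disjoint if $|v_m|\wedge|v_n|=0$ whenever $m\ne n$. A sequence $(x_n)_n$ in $E$ is weakly $p$-summable if $\sum_n |x^*(x_n)|^p<\infty$ for every $x^*\in E^*$. A set $A\subseteq E$ is Dunford--Pettis if every weakly null sequence $(x_n^*)_n$ in $E^*$ converges to $0$ uniformly on $A$, and a bounded set $A\subseteq E$ is almost Dunford--Pettis if every disjoint weakly null sequence in $E^*$ converges to $0$ uniformly on $A$; a sequence $(x_n)_n$ has one of these properties if the set $\{x_n : n\in\mathbb N\}$ has it. Then the following are equivalent. (a) $E$ has the disjoint Dunford--Pettis property of order $p$ (disjoint $DPP_p$): every disjoint weakly $p$-summable sequence in $E$ is Dunford--Pettis. (b) Every disjoint weakly $p$-summable sequence in $E$ is almost Dunford--Pettis. (c) For every disjoint weakly $p$-summable sequence $(x_n)_n$ in $E$ and every disjoint weakly null sequence $(x_n^*)_n$ in $E^*$, we have $x_n^*(x_n)\to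 0$. (d) For every disjoint weakly $p$-summable sequence $(x_n)_n$ in $E$ and every positive disjoint weakly null sequence $(x_n^*)_n$ in $E^*$, we have $x_n^*(x_n)\to 0$. (e) For every disjoint weakly $p$-summable sequence $(x_n)_n$ in $E$ and every positive weakly null sequence $(x_n^*)_n$ in $E^*$, we have $x_n^*(x_n)\to 0$. -/

import Mathlib

namespace BanachLattice

open Filter Topology

section Dual

variable {E : Type*} [NormedAddCommGroup E] [Lattice E] [HasSolidNorm E] [IsOrderedAddMonoid E]
  [NormedSpace ℝ E]

/-- The value at `x ≥ 0` of the positive part of `f`, by the Riesz–Kantorovich formula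
`f⁺(x) = sup {f y : 0 ≤ y ≤ x}`. -/
noncomputable def posVal (f : StrongDual ℝ E) (x : E) : ℝ := sSup (f '' Set.Icc 0 x)

theorem norm_le_of_nonneg_le {F : Type*} [NormedAddCommGroup F] [Lattice F] [HasSolidNorm F]
    [IsOrderedAddMonoid F] {x y : F} (hy : 0 ≤ y) (hyx : y ≤ x) : ‖y‖ ≤ ‖x‖ := by
  apply norm_le_norm_of_abs_le_abs
  rwa [abs_of_nonneg hy, abs_of_nonneg (hy.trans hyx)]

theorem apply_le_bound (f : StrongDual ℝ E) {x y : E} (hy : y ∈ Set.Icc 0 x) :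
    f y ≤ ‖f‖ * ‖x‖ :=
  ((le_abs_self _).trans (f.le_opNorm y)).trans
    (mul_le_mul_of_nonneg_left (norm_le_of_nonneg_le hy.1 hy.2) (norm_nonneg _))

theorem bddAbove_image (f : StrongDual ℝ E) (x : E) : BddAbove (f '' Set.Icc 0 x) := by
  refine ⟨‖f‖ * ‖x‖, ?_⟩
  rintro _ ⟨y, hy, rfl⟩
  exact apply_le_bound f hy

theorem apply_le_posVal (f : StrongDual ℝ E) {x y : E} (hy : y ∈ Set.Icc 0 x) :
    f y ≤ posVal f x :=
  le_csSup (bddAbove_image f x) ⟨y, hy, rfl⟩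

theorem posVal_le (f : StrongDual ℝ E) {x : E} (hx : 0 ≤ x) {c : ℝ}
    (h : ∀ y ∈ Set.Icc 0 x, f y ≤ c) : posVal f x ≤ c := by
  refine csSup_le ⟨f 0, 0, ⟨le_rfl, hx⟩, rfl⟩ ?_
  rintro _ ⟨y, hy, rfl⟩
  exact h y hy

theorem posVal_nonneg (f : StrongDual ℝ E) {x : E} (hx : 0 ≤ x) : 0 ≤ posVal f x := by
  simpa using apply_le_posVal f (x := x) (y := 0) ⟨le_rfl, hx⟩

theorem posVal_le_bound (f : StrongDual ℝ E) {x : E} (hx : 0 ≤ x) :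
    posVal f x ≤ ‖f‖ * ‖x‖ :=
  posVal_le f hx fun _ hy => apply_le_bound f hy

theorem posVal_add (f : StrongDual ℝ E) {x y : E} (hx : 0 ≤ x) (hy : 0 ≤ y) :
    posVal f (x + y) = posVal f x + posVal f y := by
  apply le_antisymm
  · refine posVal_le f (add_nonneg hx hy) fun z hz => ?_
    have h1 : z ⊓ x ∈ Set.Icc 0 x := ⟨le_inf hz.1 hx, inf_le_right⟩
    have h2 : z - z ⊓ x ∈ Set.Icc 0 y := by
      refine ⟨sub_nonneg.2 inf_le_left, ?_⟩
      rw [sub_le_iff_le_add, ← sub_le_iff_le_add']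
      exact le_inf (sub_le_self _ hy) (sub_le_iff_le_add.2 hz.2)
    have h3 : f z = f (z ⊓ x) + f (z - z ⊓ x) := by rw [← map_add]; congr 1; abel
    rw [h3]
    exact add_le_add (apply_le_posVal f h1) (apply_le_posVal f h2)
  · rw [← le_sub_iff_add_le]
    refine posVal_le f hx fun a ha => ?_
    rw [le_sub_comm]
    refine posVal_le f hy fun b hb => ?_
    rw [le_sub_iff_add_le', ← map_add]
    exact apply_le_posVal f ⟨add_nonneg ha.1 hb.1, add_le_add ha.2 hb.2⟩

theorem posVal_posPart_sub (f : StrongDual ℝ E) {a b : E} (ha : 0 ≤ a) (hb : 0 ≤ b) :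
    posVal f (a - b)⁺ - posVal f (a - b)⁻ = posVal f a - posVal f b := by
  have h : (a - b)⁺ + b = a + (a - b)⁻ := by
    have := posPart_sub_negPart (a - b)
    rw [sub_eq_sub_iff_add_eq_add] at this
    exact this
  have h' := congrArg (posVal f) h
  rw [posVal_add f (posPart_nonneg _) hb, posVal_add f ha (negPart_nonneg _)] at h'
  linarith

/-- The additive extension of `posVal f` from the positive cone to the whole space. -/
noncomputable def posHom (f : StrongDual ℝ E) : E →+ ℝ :=
  AddMonoidHom.mk' (fun x => posVal f x⁺ - posVal f x⁻) fun x y => by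
    have h : x + y = (x⁺ + y⁺) - (x⁻ + y⁻) := by
      rw [add_sub_add_comm, posPart_sub_negPart, posPart_sub_negPart]
    have h' := posVal_posPart_sub f (add_nonneg (posPart_nonneg x) (posPart_nonneg y))
      (add_nonneg (negPart_nonneg x) (negPart_nonneg y))
    rw [← h, posVal_add f (posPart_nonneg x) (posPart_nonneg y),
      posVal_add f (negPart_nonneg x) (negPart_nonneg y)] at h'
    rw [h']
    ring

theorem posHom_apply (f : StrongDual ℝ E) (x : E) :
    posHom f x = posVal f x⁺ - posVal f x⁻ := rfl

theorem posHom_bound (f : StrongDual ℝ E) (x : E) : ‖posHom f x‖ ≤ ‖f‖ * ‖x‖ := by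
  have e1 : ‖x⁺‖ ≤ ‖x‖ := by
    rw [← norm_abs_eq_norm x]
    exact norm_le_of_nonneg_le (posPart_nonneg x) (sup_le (le_abs_self x) (abs_nonneg x))
  have e2 : ‖x⁻‖ ≤ ‖x‖ := by
    rw [← norm_abs_eq_norm x]
    exact norm_le_of_nonneg_le (negPart_nonneg x) (sup_le (neg_le_abs x) (abs_nonneg x))
  have a1 := (posVal_le_bound f (posPart_nonneg x)).trans
    (mul_le_mul_of_nonneg_left e1 (norm_nonneg f))
  have a2 := (posVal_le_bound f (negPart_nonneg x)).trans
    (mul_le_mul_of_nonneg_left e2 (norm_nonneg f))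
  have b1 := posVal_nonneg f (posPart_nonneg x)
  have b2 := posVal_nonneg f (negPart_nonneg x)
  rw [posHom_apply, Real.norm_eq_abs, abs_le]
  constructor <;> linarith

/-- The positive part `f⁺` of a continuous functional `f`, as a continuous functional. -/
noncomputable def dualPosPart (f : StrongDual ℝ E) : StrongDual ℝ E :=
  (posHom f).toRealLinearMap (AddMonoidHomClass.continuous_of_bound (posHom f) ‖f‖ (posHom_bound f))

theorem dualPosPart_apply (f : StrongDual ℝ E) {x : E} (hx : 0 ≤ x) :
    dualPosPart f x = posVal f x := by
  have h0 : posVal f (0 : E) = 0 := by simp [posVal]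
  change posHom f x = _
  rw [posHom_apply, posPart_of_nonneg hx, negPart_of_nonneg hx, h0, sub_zero]

/-- The lattice structure of the dual `E*` of a Banach lattice: `f ≤ g` means `f x ≤ g x` for all
`x ≥ 0`; the suprema and infima of this order are `f ⊔ g = f + (g - f)⁺` and
`f ⊓ g = g - (g - f)⁺`. -/
@[reducible] noncomputable def dualLattice : Lattice (StrongDual ℝ E) where
  le f g := ∀ x : E, 0 ≤ x → f x ≤ g x
  le_refl _ _ _ := le_rfl
  le_trans _ _ _ h₁ h₂ x hx := (h₁ x hx).trans (h₂ x hx)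
  le_antisymm f g h₁ h₂ := by
    ext x
    rw [← posPart_sub_negPart x, map_sub, map_sub,
      le_antisymm (h₁ _ (posPart_nonneg x)) (h₂ _ (posPart_nonneg x)),
      le_antisymm (h₁ _ (negPart_nonneg x)) (h₂ _ (negPart_nonneg x))]
  sup f g := f + dualPosPart (g - f)
  inf f g := g - dualPosPart (g - f)
  le_sup_left f g x hx := by
    simpa [dualPosPart_apply _ hx] using posVal_nonneg (g - f) hx
  le_sup_right f g x hx := by
    have := apply_le_posVal (g - f) (x := x) (y := x) ⟨hx, le_rfl⟩
    simp only [add_apply, sub_apply,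
      dualPosPart_apply _ hx] at this ⊢
    linarith
  sup_le f g k h₁ h₂ x hx := by
    have : posVal (g - f) x ≤ k x - f x := posVal_le _ hx fun y hy => by
      have e₁ := h₁ (x - y) (sub_nonneg.2 hy.2)
      have e₂ := h₂ y hy.1
      simp only [map_sub, sub_apply] at e₁ ⊢
      linarith
    simp only [add_apply, dualPosPart_apply _ hx]
    linarith
  inf_le_left f g x hx := by
    have := apply_le_posVal (g - f) (x := x) (y := x) ⟨hx, le_rfl⟩
    simp only [sub_apply, dualPosPart_apply _ hx] at this ⊢
    linarith
  inf_le_right f g x hx := by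
    simpa [dualPosPart_apply _ hx] using posVal_nonneg (g - f) hx
  le_inf k f g h₁ h₂ x hx := by
    have : posVal (g - f) x ≤ g x - k x := posVal_le _ hx fun y hy => by
      have e₁ := h₁ y hy.1
      have e₂ := h₂ (x - y) (sub_nonneg.2 hy.2)
      simp only [map_sub, sub_apply] at e₂ ⊢
      linarith
    simp only [sub_apply, dualPosPart_apply _ hx]
    linarith

end Dual

/-- A sequence in a lattice-ordered group is disjoint if `|x m| ⊓ |x n| = 0` whenever `m ≠ n`. -/
def IsDisjointSeq {V : Type*} [Lattice V] [AddCommGroup V] (x : ℕ → V) : Prop :=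
  ∀ m n, m ≠ n → |x m| ⊓ |x n| = 0

/-- Convergence to `0` in the weak topology of a normed space. -/
def IsWeaklyNull {X : Type*} [NormedAddCommGroup X] [NormedSpace ℝ X] (x : ℕ → X) : Prop :=
  Tendsto (fun n => toWeakSpace ℝ X (x n)) atTop (𝓝 0)

/-- `(x n)` is weakly `p`-summable if `(f (x n))` is in `ℓ_p` for every `f` in the dual. -/
def IsWeaklyPSummable {X : Type*} [NormedAddCommGroup X] [NormedSpace ℝ X] (p : ℝ)
    (x : ℕ → X) : Prop :=
  ∀ f : StrongDual ℝ X, Summable fun n => |f (x n)| ^ p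

/-- Every weakly null sequence in the dual converges to `0` uniformly on `A`. -/
def IsDunfordPettisSet {X : Type*} [NormedAddCommGroup X] [NormedSpace ℝ X] (A : Set X) : Prop :=
  ∀ f : ℕ → StrongDual ℝ X, IsWeaklyNull f →
    TendstoUniformlyOn (fun n x => f n x) (fun _ => 0) atTop A

section Lattice

variable {E : Type*} [NormedAddCommGroup E] [Lattice E] [HasSolidNorm E] [IsOrderedAddMonoid E]
  [NormedSpace ℝ E]

/-- A sequence in the dual `E*` that is disjoint for the lattice structure of `E*`. -/
def IsDisjointDualSeq (f : ℕ → StrongDual ℝ E) : Prop :=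
  @IsDisjointSeq (StrongDual ℝ E) dualLattice _ f

/-- A sequence of positive elements of the dual lattice `E*`. -/
def IsPositiveDualSeq (f : ℕ → StrongDual ℝ E) : Prop :=
  letI : Lattice (StrongDual ℝ E) := dualLattice
  ∀ n, 0 ≤ f n

/-- `A` is bounded and every disjoint weakly null sequence in the dual converges to `0`
uniformly on `A`. -/
def IsAlmostDunfordPettisSet (A : Set E) : Prop :=
  Bornology.IsBounded A ∧
    ∀ f : ℕ → StrongDual ℝ E, IsDisjointDualSeq f → IsWeaklyNull f →
      TendstoUniformlyOn (fun n x => f n x) (fun _ => 0) atTop A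

end Lattice

/-- The disjoint Dunford–Pettis property of order `p`. -/
def HasDisjointDPP (E : Type*) [NormedAddCommGroup E] [Lattice E] [NormedSpace ℝ E]
    (p : ℝ) : Prop :=
  ∀ x : ℕ → E, IsDisjointSeq x → IsWeaklyPSummable p x → IsDunfordPettisSet (Set.range x)

end BanachLattice

/-! The substance is that (d) implies (a). Uniform convergence on the range of `x` reduces to
diagonals `f n (x n)` after passing to subsequences. Let `w n` be the component of the positive part
of `f n` carried by `|x n|`, that is `w n y = lim_k (f n)⁺ (y ⊓ k • |x n|)` for `y ≥ 0`. The `w n`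
are positive, agree with `(f n)⁺` at `x n`, and are disjoint because the `x n` are. If `w` is weakly
null, (d) gives `(f n)⁺ (x n) → 0`; the same for `-f` and subtraction give `f n (x n) → 0`.

That `w` is weakly null is `isWeaklyNull_of_le_posPart`, applied in the dual lattice. For a positive
functional `φ`, let `H n` be its component carried by `w n`. Disjointness makes the sums of the `H
n` stay below `φ`, so every subseries of `∑ H k` defines a continuous functional and tends to zero
along `f`. A sliding hump then yields `H n (f n) → 0`. Since `w n ≤ (f n)⁺`, the component `H n`
vanishes at `(f n)⁻`, whence `0 ≤ φ (w n) ≤ H n (f n)`. -/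

namespace BanachLattice

open Filter Topology

/-! ### Sliding hump for infinite matrices. -/

section SlidingHump

/-- If all subseries of the rows of an infinite matrix tend to zero along the rows, then so does
its diagonal. -/
theorem tendsto_diag_of_tendsto_subseries (a : ℕ → ℕ → ℝ) (hrow : ∀ n, Summable (a n))
    (hS : ∀ S : Set ℕ, Tendsto (fun n => ∑' k, S.indicator (a n) k) atTop (𝓝 0)) :
    Tendsto (fun n => a n n) atTop (𝓝 0) := by
  by_contra hcon
  obtain ⟨ε, hε, hfreq⟩ : ∃ ε > 0, ∃ᶠ n in atTop, ε ≤ |a n n| := by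
    by_contra! h
    refine hcon (Metric.tendsto_nhds.2 fun ε hε => ?_)
    simpa [Real.dist_eq] using h ε hε
  have hcol (k : ℕ) : Tendsto (fun n => a n k) atTop (𝓝 0) := by
    refine (hS {k}).congr fun n => ?_
    rw [tsum_eq_single k]
    · simp
    · intro j hj
      simp [hj]
  -- Head and tail will each cost less than `ε / 4`, leaving at least `ε / 2` of a diagonal entry of
  -- size `ε`.
  have hstep (N : ℕ) : ∃ n ≥ N, ε ≤ |a n n| ∧ ∑ k ∈ Finset.range N, |a n k| < ε / 4 := by
    have h : Tendsto (fun n => ∑ k ∈ Finset.range N, |a n k|) atTop (𝓝 0) := by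
      simpa using tendsto_finsetSum (Finset.range N) fun k _ => (hcol k).abs
    obtain ⟨n, h1, h2, h3⟩ := (hfreq.and_eventually
      ((h.eventually_lt_const (by positivity : (0 : ℝ) < ε / 4)).and (eventually_ge_atTop N))).exists
    exact ⟨n, h3, h1, h2⟩
  choose n hn hdiag hhead using hstep
  have htail (N : ℕ) : ∃ M > n N, ∑' k, |a (n N) (k + M)| < ε / 4 := by
    have h := tendsto_sum_nat_add fun k => |a (n N) k|
    obtain ⟨M, h1, h2⟩ := ((h.eventually_lt_const (by positivity : (0 : ℝ) < ε / 4)).and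
      (eventually_gt_atTop (n N))).exists
    exact ⟨M, h2, h1⟩
  choose M hM htail using htail
  let N : ℕ → ℕ := fun j => M^[j] 0
  have hNs (j : ℕ) : N (j + 1) = M (N j) := Function.iterate_succ_apply' M j 0
  have hNmono : StrictMono N := strictMono_nat_of_lt_succ fun j => by
    rw [hNs]
    exact (hn _).trans_lt (hM _)
  -- One index is kept from each block `[N j, N (j + 1))`, so in row `n (N j)` the middle block
  -- contributes exactly the diagonal entry.
  let S : Set ℕ := Set.range fun j => n (N j)
  have hlow (j : ℕ) : ε / 2 ≤ |∑' k, S.indicator (a (n (N j))) k| := by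
    set m := n (N j) with hm
    have hsum : Summable (S.indicator (a m)) := (hrow m).indicator S
    have hle (k : ℕ) : |S.indicator (a m) k| ≤ |a m k| := by
      by_cases hk : k ∈ S <;> simp [hk]
    have hNm : N j ≤ m := hn _
    have hmM : m < M (N j) := hM _
    have hmid : ∑ k ∈ Finset.Ico (N j) (M (N j)), S.indicator (a m) k = a m m := by
      rw [Finset.sum_eq_single m]
      · exact Set.indicator_of_mem (Set.mem_range_self j) _
      · intro k hk hkm
        refine Set.indicator_of_notMem ?_ _
        rintro ⟨i, rfl⟩
        rw [Finset.mem_Ico, ← hNs] at hk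
        rcases lt_trichotomy i j with hij | rfl | hij
        · have h1 : N (i + 1) ≤ N j := hNmono.monotone hij
          have h2 := hM (N i)
          rw [← hNs] at h2
          exact absurd hk.1 (not_le.2 (h2.trans_le h1))
        · exact hkm rfl
        · have h1 : N (j + 1) ≤ N i := hNmono.monotone hij
          exact absurd hk.2 (not_lt.2 (h1.trans (hn _)))
      · intro hk
        exact absurd (Finset.mem_Ico.2 ⟨hNm, hmM⟩) hk
    rw [← hsum.sum_add_tsum_nat_add (M (N j)),
      ← Finset.sum_range_add_sum_Ico _ (hNm.trans hmM.le), hmid]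
    have h1 : |∑ k ∈ Finset.range (N j), S.indicator (a m) k| < ε / 4 :=
      ((Finset.abs_sum_le_sum_abs _ _).trans (Finset.sum_le_sum fun k _ => hle k)).trans_lt
        (hhead _)
    have h2 : |∑' k, S.indicator (a m) (k + M (N j))| < ε / 4 := by
      have hs1 : Summable fun k => |S.indicator (a m) (k + M (N j))| :=
        (summable_nat_add_iff (M (N j))).2 hsum.abs
      have hs2 : Summable fun k => |a m (k + M (N j))| :=
        (summable_nat_add_iff (M (N j))).2 (hrow m).abs
      refine lt_of_le_of_lt ?_ (htail (N j))
      refine le_trans ?_ (hs1.tsum_le_tsum (fun k => hle _) hs2)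
      simpa using norm_tsum_le_tsum_norm (f := fun k => S.indicator (a m) (k + M (N j)))
        (by simpa using hs1)
    have h3 : ε ≤ |a m m| := hdiag _
    rw [abs_lt] at h1 h2
    rcases le_abs'.1 h3 with h | h
    · exact le_abs'.2 (Or.inl (by linarith))
    · exact le_abs'.2 (Or.inr (by linarith))
  have hlim : Tendsto (fun j => n (N j)) atTop atTop :=
    tendsto_atTop_mono (fun j => hn (N j)) hNmono.tendsto_atTop
  have h := ((hS S).comp hlim).abs.eventually_lt_const
    (by simpa using half_pos hε : |(0 : ℝ)| < ε / 2)
  obtain ⟨j, hj⟩ := h.exists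
  exact absurd hj (not_lt.2 (hlow j))

end SlidingHump

/-! ### Disjointness in lattice-ordered groups. -/

section LatticeGroup

variable {V : Type*} [AddCommGroup V] [Lattice V] [IsOrderedAddMonoid V]

theorem add_inf_le_inf_add_inf {a b c : V} (ha : 0 ≤ a) (hb : 0 ≤ b) (hc : 0 ≤ c) :
    (a + b) ⊓ c ≤ a ⊓ c + b ⊓ c := by
  rw [inf_add, add_inf, add_inf]
  refine le_inf (le_inf inf_le_left (inf_le_right.trans ?_))
    (le_inf (inf_le_right.trans ?_) (inf_le_right.trans ?_))
  · exact le_add_of_nonneg_left ha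
  · exact le_add_of_nonneg_right hb
  · exact le_add_of_nonneg_right hc

theorem add_inf_eq_zero {a b c : V} (ha : 0 ≤ a) (hb : 0 ≤ b) (hc : 0 ≤ c) (hac : a ⊓ c = 0)
    (hbc : b ⊓ c = 0) : (a + b) ⊓ c = 0 := by
  refine le_antisymm ?_ (le_inf (add_nonneg ha hb) hc)
  simpa [hac, hbc] using add_inf_le_inf_add_inf ha hb hc

theorem nsmul_inf_eq_zero {a c : V} (ha : 0 ≤ a) (hc : 0 ≤ c) (hac : a ⊓ c = 0) (k : ℕ) :
    (k • a) ⊓ c = 0 := by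
  induction k with
  | zero => simpa using hc
  | succ k ih =>
    rw [succ_nsmul]
    exact add_inf_eq_zero (nsmul_nonneg ha k) ha hc ih hac

theorem nsmul_inf_nsmul_eq_zero {a c : V} (ha : 0 ≤ a) (hc : 0 ≤ c) (hac : a ⊓ c = 0)
    (k l : ℕ) : (k • a) ⊓ (l • c) = 0 := by
  have h := nsmul_inf_eq_zero ha hc hac k
  rw [inf_comm] at h ⊢
  exact nsmul_inf_eq_zero hc (nsmul_nonneg ha k) h l

theorem sum_inf_eq_zero {ι : Type*} (s : Finset ι) {a : ι → V} {c : V} (ha : ∀ i, 0 ≤ a i)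
    (hc : 0 ≤ c) (hac : ∀ i ∈ s, a i ⊓ c = 0) : (∑ i ∈ s, a i) ⊓ c = 0 := by
  classical
  induction s using Finset.induction_on with
  | empty => simpa using hc
  | insert i s hi ih =>
    rw [Finset.sum_insert hi]
    exact add_inf_eq_zero (ha i) (Finset.sum_nonneg fun j _ => ha j) hc
      (hac i (Finset.mem_insert_self i s)) (ih fun j hj => hac j (Finset.mem_insert_of_mem hj))

/-- For disjoint elements the sum is the supremum, by `a ⊓ b + a ⊔ b = a + b`. -/
theorem sum_le_of_pairwise_inf_eq_zero {ι : Type*} (s : Finset ι) {a : ι → V} {y : V}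
    (hy : 0 ≤ y) (ha : ∀ i, 0 ≤ a i) (hd : ∀ i j, i ≠ j → a i ⊓ a j = 0) (hay : ∀ i, a i ≤ y) :
    ∑ i ∈ s, a i ≤ y := by
  classical
  induction s using Finset.induction_on with
  | empty => simpa using hy
  | insert i s hi ih =>
    have h : (∑ j ∈ s, a j) ⊓ a i = 0 := sum_inf_eq_zero s ha (ha i) fun j hj =>
      hd j i fun hji => hi (hji ▸ hj)
    rw [Finset.sum_insert hi, add_comm, ← inf_add_sup, h, zero_add]
    exact sup_le ih (hay i)

end LatticeGroup

/-! ### Components of positive functionals and weakly null sequences. -/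

section Dual

variable {E : Type*} [NormedAddCommGroup E] [Lattice E] [HasSolidNorm E] [IsOrderedAddMonoid E]
  [NormedSpace ℝ E]

theorem isWeaklyNull_iff {X : Type*} [NormedAddCommGroup X] [NormedSpace ℝ X] {x : ℕ → X} :
    IsWeaklyNull x ↔ ∀ φ : StrongDual ℝ X, Tendsto (fun n => φ (x n)) atTop (𝓝 0) := by
  have hinj : Function.Injective (topDualPairing ℝ X).flip := fun a b hab =>
    (SeparatingDual.eq_iff_forall_dual_eq (R := ℝ)).2 fun φ => LinearMap.congr_fun hab φ
  refine (WeakBilin.tendsto_iff_forall_eval_tendsto _ hinj).trans (forall_congr' fun φ => ?_)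
  have h0 : (topDualPairing ℝ X).flip 0 φ = 0 := map_zero φ
  exact iff_of_eq (congrArg (fun c => Tendsto (fun n => φ (x n)) atTop (𝓝 c)) h0)

theorem apply_mono {V : Type*} [NormedAddCommGroup V] [PartialOrder V] [IsOrderedAddMonoid V]
    [NormedSpace ℝ V] {f : StrongDual ℝ V} (hf : ∀ y, 0 ≤ y → 0 ≤ f y) {y z : V}
    (h : y ≤ z) : f y ≤ f z := by
  simpa using hf (z - y) (sub_nonneg.2 h)

/-- A bounded additive function on the positive cone extends to a continuous functional. -/
theorem exists_dual_eq_on_nonneg {g : E → ℝ} {c : ℝ} (hc : 0 ≤ c)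
    (hadd : ∀ y z, 0 ≤ y → 0 ≤ z → g (y + z) = g y + g z)
    (h0 : ∀ y, 0 ≤ y → 0 ≤ g y) (hb : ∀ y, 0 ≤ y → g y ≤ c * ‖y‖) :
    ∃ h : StrongDual ℝ E, ∀ y, 0 ≤ y → h y = g y := by
  have hg0 : g 0 = 0 := by simpa using hadd 0 0 le_rfl le_rfl
  let H : E →+ ℝ := AddMonoidHom.mk' (fun x => g x⁺ - g x⁻) fun x y => by
    have h : (x + y)⁺ + (x⁻ + y⁻) = (x⁺ + y⁺) + (x + y)⁻ := by
      rw [← sub_eq_sub_iff_add_eq_add, posPart_sub_negPart, add_sub_add_comm,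
        posPart_sub_negPart, posPart_sub_negPart]
    have h' := congrArg g h
    rw [hadd _ _ (posPart_nonneg _) (add_nonneg (negPart_nonneg _) (negPart_nonneg _)),
      hadd _ _ (add_nonneg (posPart_nonneg _) (posPart_nonneg _)) (negPart_nonneg _),
      hadd _ _ (posPart_nonneg _) (posPart_nonneg _),
      hadd _ _ (negPart_nonneg _) (negPart_nonneg _)] at h'
    linarith
  have hH (x : E) : ‖H x‖ ≤ c * ‖x‖ := by
    have e1 : ‖x⁺‖ ≤ ‖x‖ := by
      rw [← norm_abs_eq_norm x]
      exact norm_le_of_nonneg_le (posPart_nonneg x) (sup_le (le_abs_self x) (abs_nonneg x))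
    have e2 : ‖x⁻‖ ≤ ‖x‖ := by
      rw [← norm_abs_eq_norm x]
      exact norm_le_of_nonneg_le (negPart_nonneg x) (sup_le (neg_le_abs x) (abs_nonneg x))
    have a1 := (hb _ (posPart_nonneg x)).trans (mul_le_mul_of_nonneg_left e1 hc)
    have a2 := (hb _ (negPart_nonneg x)).trans (mul_le_mul_of_nonneg_left e2 hc)
    have b1 := h0 _ (posPart_nonneg x)
    have b2 := h0 _ (negPart_nonneg x)
    change ‖g x⁺ - g x⁻‖ ≤ _
    rw [Real.norm_eq_abs, abs_le]
    constructor <;> linarith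
  refine ⟨H.toRealLinearMap (AddMonoidHomClass.continuous_of_bound H c hH), fun y hy => ?_⟩
  change g y⁺ - g y⁻ = g y
  rw [posPart_of_nonneg hy, negPart_of_nonneg hy, hg0, sub_zero]

/-- The component of a positive functional `f` carried by the band of `u ≥ 0`. -/
theorem exists_component {f : StrongDual ℝ E} (hf : ∀ y, 0 ≤ y → 0 ≤ f y) {u : E} (hu : 0 ≤ u) :
    ∃ h : StrongDual ℝ E, ∀ y, 0 ≤ y →
      Tendsto (fun k : ℕ => f (y ⊓ k • u)) atTop (𝓝 (h y)) := by
  have hku (k : ℕ) : 0 ≤ k • u := nsmul_nonneg hu k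
  have hmono (y : E) : Monotone fun k : ℕ => f (y ⊓ k • u) := fun k l hkl =>
    apply_mono hf (inf_le_inf_left y (nsmul_le_nsmul_left hu hkl))
  have hbdd (y : E) : BddAbove (Set.range fun k : ℕ => f (y ⊓ k • u)) := by
    refine ⟨f y, ?_⟩
    rintro _ ⟨k, rfl⟩
    exact apply_mono hf inf_le_left
  have hlim (y : E) : Tendsto (fun k : ℕ => f (y ⊓ k • u)) atTop (𝓝 (⨆ k : ℕ, f (y ⊓ k • u))) :=
    tendsto_atTop_ciSup (hmono y) (hbdd y)
  suffices hex : ∃ h : StrongDual ℝ E, ∀ y, 0 ≤ y → h y = ⨆ k : ℕ, f (y ⊓ k • u) by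
    obtain ⟨h, hh⟩ := hex
    exact ⟨h, fun y hy => by rw [hh y hy]; exact hlim y⟩
  refine exists_dual_eq_on_nonneg (norm_nonneg f) (fun y z hy hz => ?_) (fun y hy => ?_)
    (fun y hy => ?_)
  · apply le_antisymm
    · refine le_of_tendsto_of_tendsto' (hlim (y + z)) ((hlim y).add (hlim z)) fun k => ?_
      rw [← map_add]
      exact apply_mono hf (add_inf_le_inf_add_inf hy hz (hku k))
    · refine le_of_tendsto' ((hlim y).add (hlim z)) fun k => ?_
      -- Two truncations at `k • u` add up to at most one truncation at `(k + k) • u`.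
      refine le_trans ?_ (le_ciSup (hbdd (y + z)) (k + k))
      rw [← map_add]
      refine apply_mono hf (le_inf (add_le_add inf_le_left inf_le_left) ?_)
      rw [add_nsmul]
      exact add_le_add inf_le_right inf_le_right
  · exact ge_of_tendsto' (hlim y) fun k => hf _ (le_inf hy (hku k))
  · refine le_of_tendsto' (hlim y) fun k => ?_
    exact apply_le_bound f ⟨le_inf hy (hku k), inf_le_left⟩

/-- Positive disjoint sequences dominated by the positive parts of a weakly null sequence are
weakly null. -/
theorem isWeaklyNull_of_le_posPart {f w : ℕ → E} (hf : IsWeaklyNull f) (hw : ∀ n, 0 ≤ w n)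
    (hd : ∀ m n, m ≠ n → w m ⊓ w n = 0) (hle : ∀ n, w n ≤ (f n)⁺) : IsWeaklyNull w := by
  rw [isWeaklyNull_iff] at hf ⊢
  -- Every functional is a difference of positive ones: `φ = φ⁺ - (φ⁺ - φ)`.
  suffices key : ∀ φ : StrongDual ℝ E, (∀ y, 0 ≤ y → 0 ≤ φ y) →
      Tendsto (fun n => φ (w n)) atTop (𝓝 0) by
    intro φ
    have h1 := key (dualPosPart φ) fun y hy => by
      rw [dualPosPart_apply φ hy]
      exact posVal_nonneg φ hy
    have h2 := key (dualPosPart φ - φ) fun y hy => by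
      rw [sub_apply, dualPosPart_apply φ hy, sub_nonneg]
      exact apply_le_posVal φ ⟨hy, le_rfl⟩
    simpa using h1.sub h2
  intro φ hφ
  choose H hH using fun n => exists_component hφ (hw n)
  have hHnonneg (n : ℕ) (y : E) (hy : 0 ≤ y) : 0 ≤ H n y :=
    ge_of_tendsto' (hH n y hy) fun k => hφ _ (le_inf hy (nsmul_nonneg (hw n) k))
  -- For fixed `k` the elements `y ⊓ k • w n` are pairwise disjoint and below `y`, hence so is their
  -- sum.
  have hHsum (s : Finset ℕ) (y : E) (hy : 0 ≤ y) : ∑ n ∈ s, H n y ≤ φ y := by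
    refine le_of_tendsto' (tendsto_finsetSum s fun n _ => hH n y hy) fun k => ?_
    rw [← map_sum]
    have h0 (n : ℕ) : 0 ≤ y ⊓ k • w n := le_inf hy (nsmul_nonneg (hw n) k)
    refine apply_mono hφ (sum_le_of_pairwise_inf_eq_zero s hy h0 (fun i j hij => ?_)
      fun n => inf_le_left)
    refine le_antisymm ?_ (le_inf (h0 i) (h0 j))
    rw [← nsmul_inf_nsmul_eq_zero (hw i) (hw j) (hd i j hij) k k]
    exact inf_le_inf inf_le_right inf_le_right
  have hHabs (n : ℕ) (y : E) : |H n y| ≤ H n |y| := by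
    refine abs_le'.2 ⟨apply_mono (hHnonneg n) (le_abs_self y), ?_⟩
    rw [← map_neg]
    exact apply_mono (hHnonneg n) (neg_le_abs y)
  have hsum (y : E) : Summable fun n => H n y := by
    refine Summable.of_abs (summable_of_sum_le (c := φ |y|) (fun _ => abs_nonneg _) fun s => ?_)
    exact (Finset.sum_le_sum fun n _ => hHabs n y).trans (hHsum s _ (abs_nonneg y))
  have hdiag : Tendsto (fun n => H n (f n)) atTop (𝓝 0) := by
    refine tendsto_diag_of_tendsto_subseries (fun n k => H k (f n)) (fun n => hsum _) fun S => ?_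
    have hsumS (y : E) : Summable (S.indicator fun k => H k y) := (hsum y).indicator S
    let L : E →ₗ[ℝ] ℝ :=
      { toFun y := ∑' k, S.indicator (fun k => H k y) k
        map_add' y z := by
          rw [← (hsumS y).tsum_add (hsumS z)]
          congr 1 with k
          by_cases hk : k ∈ S <;> simp [hk]
        map_smul' r y := by
          rw [RingHom.id_apply, smul_eq_mul, ← tsum_mul_left]
          congr 1 with k
          by_cases hk : k ∈ S <;> simp [hk] }
    have hL (y : E) : ‖L y‖ ≤ ‖φ‖ * ‖y‖ := by
      have h1 : φ |y| ≤ ‖φ‖ * ‖y‖ := by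
        rw [← norm_abs_eq_norm y]
        exact apply_le_bound φ ⟨abs_nonneg y, le_rfl⟩
      refine (norm_tsum_le_tsum_norm (hsumS y).norm).trans (le_trans ?_ h1)
      refine Real.tsum_le_of_sum_le (fun _ => norm_nonneg _) fun s => ?_
      refine (Finset.sum_le_sum fun n _ => ?_).trans (hHsum s _ (abs_nonneg y))
      exact (norm_indicator_le_norm_self _ _).trans (hHabs n y)
    exact hf (L.mkContinuous ‖φ‖ hL)
  refine squeeze_zero (fun n => hφ _ (hw n)) (fun n => ?_) hdiag
  -- Already at `k = 1` the truncation of `(f n)⁺` dominates `w n`.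
  have hpos : φ (w n) ≤ H n (f n)⁺ := by
    refine ge_of_tendsto (hH n _ (posPart_nonneg _)) ?_
    filter_upwards [eventually_ge_atTop 1] with k hk
    exact apply_mono hφ (le_inf (hle n) (by simpa using nsmul_le_nsmul_left (hw n) hk))
  have hperp : w n ⊓ (f n)⁻ = 0 := by
    refine le_antisymm ?_ (le_inf (hw n) (negPart_nonneg _))
    rw [← posPart_inf_negPart_eq_zero (f n)]
    exact inf_le_inf_right _ (hle n)
  have hneg : H n (f n)⁻ = 0 := by
    refine tendsto_nhds_unique (hH n _ (negPart_nonneg _)) ?_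
    refine tendsto_const_nhds.congr fun k => ?_
    rw [inf_comm, nsmul_inf_eq_zero (hw n) (negPart_nonneg _) hperp k, map_zero]
  rw [← posPart_sub_negPart (f n), map_sub, hneg, sub_zero]
  exact hpos

end Dual

/-! ### The dual as a normed lattice, and disjoint components in it. -/

section DualLattice

variable {E : Type*} [NormedAddCommGroup E] [Lattice E] [HasSolidNorm E] [IsOrderedAddMonoid E]
  [NormedSpace ℝ E]

theorem dual_isOrderedAddMonoid :
    letI : Lattice (StrongDual ℝ E) := dualLattice
    IsOrderedAddMonoid (StrongDual ℝ E) :=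
  letI : Lattice (StrongDual ℝ E) := dualLattice
  { add_le_add_left := fun f g h k x hx => by
      have := h x hx
      simp only [add_apply]
      linarith }

theorem dual_posPart_eq (f : StrongDual ℝ E) :
    letI : Lattice (StrongDual ℝ E) := dualLattice
    f⁺ = dualPosPart f := by
  let : Lattice (StrongDual ℝ E) := dualLattice
  have : IsOrderedAddMonoid (StrongDual ℝ E) := dual_isOrderedAddMonoid
  rw [posPart_def, sup_comm]
  change 0 + dualPosPart (f - 0) = _
  rw [zero_add, sub_zero]

theorem dual_abs_apply_le (f : StrongDual ℝ E) {x : E} (hx : 0 ≤ x) :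
    letI : Lattice (StrongDual ℝ E) := dualLattice
    |f| x ≤ ‖f‖ * ‖x‖ := by
  -- Since `|f| = f + (-2f)⁺`, the bound concerns `f (x - 2y)` for `0 ≤ y ≤ x`, where `|x - 2y| ≤
  -- x`.
  change (f + dualPosPart (-f - f)) x ≤ _
  rw [add_apply, dualPosPart_apply _ hx, ← le_sub_iff_add_le']
  refine posVal_le _ hx fun y hy => ?_
  have h : f (x - y - y) ≤ ‖f‖ * ‖x‖ := by
    refine ((le_abs_self _).trans (f.le_opNorm _)).trans
      (mul_le_mul_of_nonneg_left (norm_le_norm_of_abs_le_abs ?_) (norm_nonneg _))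
    rw [abs_of_nonneg hx]
    refine abs_le'.2 ⟨(sub_le_self _ hy.1).trans (sub_le_self _ hy.1), ?_⟩
    have : -(x - y - y) = y - (x - y) := by abel
    rw [this]
    exact (sub_le_self _ (sub_nonneg.2 hy.2)).trans hy.2
  simp only [map_sub, sub_apply, neg_apply] at h ⊢
  linarith

theorem abs_apply_le_dual_abs (f : StrongDual ℝ E) (x : E) :
    letI : Lattice (StrongDual ℝ E) := dualLattice
    |f x| ≤ |f| |x| := by
  let : Lattice (StrongDual ℝ E) := dualLattice
  have h1 : f ≤ |f| := le_sup_left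
  have h2 : -f ≤ |f| := le_sup_right
  have a1 := h1 _ (posPart_nonneg x)
  have a2 := h2 _ (posPart_nonneg x)
  have b1 := h1 _ (negPart_nonneg x)
  have b2 := h2 _ (negPart_nonneg x)
  have e1 : f x = f x⁺ - f x⁻ := by rw [← map_sub, posPart_sub_negPart]
  have e2 : |f| |x| = |f| x⁺ + |f| x⁻ := by rw [← map_add, posPart_add_negPart]
  rw [neg_apply] at a2 b2
  rw [e1, e2]
  exact abs_le.2 ⟨by linarith, by linarith⟩

/-- Needed so that results on normed lattices apply to the dual itself. -/
theorem dual_hasSolidNorm :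
    letI : Lattice (StrongDual ℝ E) := dualLattice
    HasSolidNorm (StrongDual ℝ E) := by
  let : Lattice (StrongDual ℝ E) := dualLattice
  refine ⟨fun f g hfg => f.opNorm_le_bound (norm_nonneg g) fun x => ?_⟩
  rw [← norm_abs_eq_norm x]
  exact ((abs_apply_le_dual_abs f x).trans (hfg _ (abs_nonneg x))).trans
    (dual_abs_apply_le g (abs_nonneg x))

/-- The components of two functionals carried by disjoint elements are disjoint. -/
theorem dual_inf_component_eq_zero {f g h k : StrongDual ℝ E} (hf : ∀ y, 0 ≤ y → 0 ≤ f y)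
    (hg : ∀ y, 0 ≤ y → 0 ≤ g y) {u v : E} (hu : 0 ≤ u) (hv : 0 ≤ v) (huv : u ⊓ v = 0)
    (hh : ∀ y, 0 ≤ y → Tendsto (fun j : ℕ => f (y ⊓ j • u)) atTop (𝓝 (h y)))
    (hk : ∀ y, 0 ≤ y → Tendsto (fun j : ℕ => g (y ⊓ j • v)) atTop (𝓝 (k y))) :
    letI : Lattice (StrongDual ℝ E) := dualLattice
    h ⊓ k = 0 := by
  let : Lattice (StrongDual ℝ E) := dualLattice
  have hh0 : 0 ≤ h := fun y hy =>
    ge_of_tendsto' (hh y hy) fun j => hf _ (le_inf hy (nsmul_nonneg hu j))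
  have hk0 : 0 ≤ k := fun y hy =>
    ge_of_tendsto' (hk y hy) fun j => hg _ (le_inf hy (nsmul_nonneg hv j))
  refine le_antisymm (fun y hy => ?_) (le_inf hh0 hk0)
  -- Split `y` at `z = y ⊓ j • v`: `h` vanishes at `z`, and `k (y - z) = k y - g z` tends to zero
  -- with `j`.
  have hlim : Tendsto (fun j : ℕ => k y - g (y ⊓ j • v)) atTop (𝓝 0) := by
    simpa using (hk y hy).const_sub (k y)
  refine ge_of_tendsto' hlim fun j => ?_
  have hz : 0 ≤ y ⊓ j • v := le_inf hy (nsmul_nonneg hv j)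
  have e1 : h (y ⊓ j • v) = 0 := by
    refine tendsto_nhds_unique (hh _ hz) (tendsto_const_nhds.congr fun i => ?_)
    rw [inf_assoc, inf_comm (j • v), nsmul_inf_nsmul_eq_zero hu hv huv, inf_eq_right.2 hy,
      map_zero]
  have e2 : k (y ⊓ j • v) = g (y ⊓ j • v) := by
    refine tendsto_nhds_unique (hk _ hz) (tendsto_const_nhds.congr' ?_)
    filter_upwards [eventually_ge_atTop j] with i hi
    rw [inf_assoc, inf_eq_left.2 (nsmul_le_nsmul_left hv hi)]
  have i1 : (h ⊓ k) (y ⊓ j • v) ≤ h (y ⊓ j • v) :=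
    (inf_le_left : h ⊓ k ≤ h) _ hz
  have i2 : (h ⊓ k) (y - y ⊓ j • v) ≤ k (y - y ⊓ j • v) :=
    (inf_le_right : h ⊓ k ≤ k) _ (sub_nonneg.2 inf_le_left)
  rw [map_sub, map_sub] at i2
  linarith

/-- Evaluating the positive parts of a weakly null sequence of functionals along a disjoint
sequence amounts to evaluating a positive disjoint weakly null sequence. -/
theorem exists_disjoint_weaklyNull_apply_eq {f : ℕ → StrongDual ℝ E} (hf : IsWeaklyNull f)
    {x : ℕ → E} (hx : IsDisjointSeq x) :
    ∃ w : ℕ → StrongDual ℝ E, IsPositiveDualSeq w ∧ IsDisjointDualSeq w ∧ IsWeaklyNull w ∧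
      ∀ n, w n (x n) = dualPosPart (f n) (x n) := by
  let : Lattice (StrongDual ℝ E) := dualLattice
  have : IsOrderedAddMonoid (StrongDual ℝ E) := dual_isOrderedAddMonoid
  have : HasSolidNorm (StrongDual ℝ E) := dual_hasSolidNorm
  have hpos (n : ℕ) (y : E) (hy : 0 ≤ y) : 0 ≤ dualPosPart (f n) y := by
    rw [dualPosPart_apply _ hy]
    exact posVal_nonneg _ hy
  choose w hw using fun n => exists_component (hpos n) (abs_nonneg (x n))
  have hw0 (n : ℕ) : 0 ≤ w n := fun y hy =>
    ge_of_tendsto' (hw n y hy) fun j => hpos n _ (le_inf hy (nsmul_nonneg (abs_nonneg _) j))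
  have hd (m n : ℕ) (hmn : m ≠ n) : w m ⊓ w n = 0 :=
    dual_inf_component_eq_zero (hpos m) (hpos n) (abs_nonneg _) (abs_nonneg _) (hx m n hmn)
      (hw m) (hw n)
  -- Below `|x n|` the truncation at `j • |x n|` has no effect once `j ≥ 1`.
  have hval (n : ℕ) (y : E) (hy : 0 ≤ y) (hyx : y ≤ |x n|) : w n y = dualPosPart (f n) y := by
    refine tendsto_nhds_unique (hw n y hy) (tendsto_const_nhds.congr' ?_)
    filter_upwards [eventually_ge_atTop 1] with j hj
    have h : y ≤ j • |x n| :=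
      hyx.trans (by simpa using nsmul_le_nsmul_left (abs_nonneg (x n)) hj)
    rw [inf_eq_left.2 h]
  refine ⟨w, hw0, fun m n hmn => ?_, ?_, fun n => ?_⟩
  · rw [abs_of_nonneg (hw0 m), abs_of_nonneg (hw0 n)]
    exact hd m n hmn
  · refine isWeaklyNull_of_le_posPart hf hw0 hd fun n => ?_
    rw [dual_posPart_eq]
    exact fun y hy => le_of_tendsto' (hw n y hy) fun j => apply_mono (hpos n) inf_le_left
  · rw [← posPart_sub_negPart (x n), map_sub, map_sub,
      hval n _ (posPart_nonneg _) (sup_le (le_abs_self _) (abs_nonneg _)),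
      hval n _ (negPart_nonneg _) (sup_le (neg_le_abs _) (abs_nonneg _))]

theorem dualPosPart_sub_dualPosPart_neg (f : StrongDual ℝ E) :
    dualPosPart f - dualPosPart (-f) = f := by
  let : Lattice (StrongDual ℝ E) := dualLattice
  have : IsOrderedAddMonoid (StrongDual ℝ E) := dual_isOrderedAddMonoid
  rw [← dual_posPart_eq, ← dual_posPart_eq, posPart_neg, posPart_sub_negPart]

end DualLattice

/-! ### Weakly summable sequences and uniform convergence along diagonals. -/

section Sequences

variable {X : Type*} [NormedAddCommGroup X] [NormedSpace ℝ X]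

theorem IsWeaklyNull.comp {x : ℕ → X} (hx : IsWeaklyNull x) {n : ℕ → ℕ}
    (hn : Tendsto n atTop atTop) : IsWeaklyNull (x ∘ n) :=
  isWeaklyNull_iff.2 fun φ => (isWeaklyNull_iff.1 hx φ).comp hn

theorem IsWeaklyNull.neg {x : ℕ → X} (hx : IsWeaklyNull x) : IsWeaklyNull (-x) := by
  rw [isWeaklyNull_iff] at hx ⊢
  intro φ
  simpa using (hx φ).neg

theorem IsWeaklyNull.tendsto_apply {f : ℕ → StrongDual ℝ X} (hf : IsWeaklyNull f) (x : X) :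
    Tendsto (fun n => f n x) atTop (𝓝 0) :=
  isWeaklyNull_iff.1 hf (NormedSpace.inclusionInDoubleDual ℝ X x)

theorem IsWeaklyPSummable.comp {p : ℝ} {x : ℕ → X} (hx : IsWeaklyPSummable p x) {n : ℕ → ℕ}
    (hn : StrictMono n) : IsWeaklyPSummable p (x ∘ n) :=
  fun f => (hx f).comp_injective hn.injective

/-- Uniform boundedness for the `x n` as functionals on the dual, which is complete even if `X` is
not. -/
theorem IsWeaklyPSummable.isBounded_range {p : ℝ} (hp : 0 < p) {x : ℕ → X}
    (hx : IsWeaklyPSummable p x) : Bornology.IsBounded (Set.range x) := by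
  obtain ⟨C, hC⟩ := banach_steinhaus (g := fun n => NormedSpace.inclusionInDoubleDual ℝ X (x n))
    fun f => by
      obtain ⟨B, hB⟩ := (hx f).tendsto_atTop_zero.bddAbove_range
      refine ⟨B ^ p⁻¹, fun n => ?_⟩
      have h : |f (x n)| ^ p ≤ B := hB ⟨n, rfl⟩
      exact (Real.le_rpow_inv_iff_of_pos (abs_nonneg _)
        ((Real.rpow_nonneg (abs_nonneg _) p).trans h) hp).2 h
  refine isBounded_iff_forall_norm_le.2 ⟨C, ?_⟩
  rintro _ ⟨n, rfl⟩
  exact ((NormedSpace.inclusionInDoubleDualLi ℝ (E := X)).norm_map (x n)).symm.trans_le (hC n)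

theorem IsDisjointSeq.comp {V : Type*} [Lattice V] [AddCommGroup V] {x : ℕ → V}
    (hx : IsDisjointSeq x) {n : ℕ → ℕ} (hn : StrictMono n) : IsDisjointSeq (x ∘ n) :=
  fun _ _ hij => hx _ _ (hn.injective.ne hij)

theorem tendsto_diag_of_tendstoUniformlyOn_range {f : ℕ → StrongDual ℝ X} {x : ℕ → X}
    (h : TendstoUniformlyOn (fun n x => f n x) (fun _ => 0) atTop (Set.range x)) :
    Tendsto (fun n => f n (x n)) atTop (𝓝 0) := by
  rw [Metric.tendstoUniformlyOn_iff] at h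
  refine Metric.tendsto_nhds.2 fun ε hε => (h ε hε).mono fun n hn => ?_
  rw [dist_comm]
  exact hn _ (Set.mem_range_self n)

/-- A pointwise null sequence of functionals converges uniformly on the range of a sequence as soon
as it does so along the diagonals of all pairs of subsequences. -/
theorem tendstoUniformlyOn_range_of_tendsto_diag {f : ℕ → StrongDual ℝ X} {x : ℕ → X}
    (hpt : ∀ m, Tendsto (fun n => f n (x m)) atTop (𝓝 0))
    (hdiag : ∀ n m : ℕ → ℕ, StrictMono n → StrictMono m →
      Tendsto (fun j => f (n j) (x (m j))) atTop (𝓝 0)) :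
    TendstoUniformlyOn (fun n x => f n x) (fun _ => 0) atTop (Set.range x) := by
  rw [Metric.tendstoUniformlyOn_iff]
  by_contra! hcon
  obtain ⟨ε, hε, hfreq⟩ := hcon
  -- Pointwise convergence eventually handles the finitely many `x m` with `m ≤ N`, so a bad pair
  -- must have `m > N` as well.
  have hstep (N : ℕ) : ∃ q : ℕ × ℕ, N < q.1 ∧ N < q.2 ∧ ε ≤ |f q.1 (x q.2)| := by
    have hsmall : ∀ᶠ n in atTop, ∀ m ∈ Finset.range (N + 1), |f n (x m)| < ε := by
      rw [Filter.eventually_all_finset]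
      intro m _
      simpa [Real.dist_eq] using Metric.tendsto_nhds.1 (hpt m) ε hε
    obtain ⟨n, hn, h1, h2⟩ :=
      (hfreq.and_eventually (hsmall.and (eventually_gt_atTop N))).exists
    obtain ⟨_, ⟨m, rfl⟩, hm⟩ := hn
    rw [dist_comm, Real.dist_eq, sub_zero] at hm
    refine ⟨(n, m), h2, ?_, hm⟩
    by_contra hmN
    exact absurd (h1 m (Finset.mem_range.2 (by omega))) (not_lt.2 hm)
  choose q hq1 hq2 hq using hstep
  -- Starting each search beyond both previous coordinates makes both index sequences strictly
  -- increasing.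
  let r : ℕ → ℕ × ℕ := fun j => (fun s : ℕ × ℕ => q (max s.1 s.2))^[j] (q 0)
  have hr (j : ℕ) : r (j + 1) = q (max (r j).1 (r j).2) := Function.iterate_succ_apply' _ j _
  have hlow (j : ℕ) : ε ≤ |f (r j).1 (x (r j).2)| := by
    cases j with
    | zero => exact hq 0
    | succ j =>
      rw [hr]
      exact hq _
  have h := hdiag (fun j => (r j).1) (fun j => (r j).2)
    (strictMono_nat_of_lt_succ fun j => by
      rw [hr]
      exact (le_max_left _ _).trans_lt (hq1 _))
    (strictMono_nat_of_lt_succ fun j => by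
      rw [hr]
      exact (le_max_right _ _).trans_lt (hq2 _))
  obtain ⟨j, hj⟩ := (Metric.tendsto_nhds.1 h ε hε).exists
  rw [Real.dist_eq, sub_zero] at hj
  exact absurd hj (not_lt.2 (hlow j))

end Sequences

end BanachLattice

/-! ### The equivalences. -/

theorem theorem2p2 {E : Type*} [NormedAddCommGroup E] [Lattice E] [HasSolidNorm E]
    [IsOrderedAddMonoid E] [NormedSpace ℝ E] [IsOrderedModule ℝ E] [CompleteSpace E]
    (p : ℝ) (hp : 1 ≤ p) :
    List.TFAE [
      BanachLattice.HasDisjointDPP E p,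
      ∀ x : ℕ → E, BanachLattice.IsDisjointSeq x → BanachLattice.IsWeaklyPSummable p x →
        BanachLattice.IsAlmostDunfordPettisSet (Set.range x),
      ∀ x : ℕ → E, BanachLattice.IsDisjointSeq x → BanachLattice.IsWeaklyPSummable p x →
        ∀ f : ℕ → StrongDual ℝ E, BanachLattice.IsDisjointDualSeq f →
          BanachLattice.IsWeaklyNull f → Filter.Tendsto (fun n => f n (x n)) Filter.atTop (nhds 0),
      ∀ x : ℕ → E, BanachLattice.IsDisjointSeq x → BanachLattice.IsWeaklyPSummable p x →
        ∀ f : ℕ → StrongDual ℝ E, BanachLattice.IsPositiveDualSeq f →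
          BanachLattice.IsDisjointDualSeq f → BanachLattice.IsWeaklyNull f →
            Filter.Tendsto (fun n => f n (x n)) Filter.atTop (nhds 0),
      ∀ x : ℕ → E, BanachLattice.IsDisjointSeq x → BanachLattice.IsWeaklyPSummable p x →
        ∀ f : ℕ → StrongDual ℝ E, BanachLattice.IsPositiveDualSeq f →
          BanachLattice.IsWeaklyNull f →
            Filter.Tendsto (fun n => f n (x n)) Filter.atTop (nhds 0)] := by
  tfae_have 1 → 2 := fun h x hx hxp =>
    ⟨hxp.isBounded_range (by linarith), fun f _ hf => h x hx hxp f hf⟩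
  tfae_have 2 → 3 := fun h x hx hxp f hfd hf =>
    BanachLattice.tendsto_diag_of_tendstoUniformlyOn_range ((h x hx hxp).2 f hfd hf)
  tfae_have 3 → 4 := fun h x hx hxp f _ hfd hf => h x hx hxp f hfd hf
  tfae_have 1 → 5 := fun h x hx hxp f _ hf =>
    BanachLattice.tendsto_diag_of_tendstoUniformlyOn_range (h x hx hxp f hf)
  tfae_have 5 → 4 := fun h x hx hxp f hf0 _ hf => h x hx hxp f hf0 hf
  tfae_have 4 → 1 := by
    intro h x hx hxp f hf
    refine BanachLattice.tendstoUniformlyOn_range_of_tendsto_diag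
      (fun m => hf.tendsto_apply (x m)) fun n m hn hm => ?_
    have hg := hf.comp hn.tendsto_atTop
    have hy := hx.comp hm
    -- `u` and `v` replace the positive and negative parts of the functionals, evaluated along the
    -- disjoint sequence.
    obtain ⟨u, hu0, hud, hu, hux⟩ := BanachLattice.exists_disjoint_weaklyNull_apply_eq hg hy
    obtain ⟨v, hv0, hvd, hv, hvx⟩ := BanachLattice.exists_disjoint_weaklyNull_apply_eq hg.neg hy
    have hlim := (h _ hy (hxp.comp hm) u hu0 hud hu).sub (h _ hy (hxp.comp hm) v hv0 hvd hv)
    rw [sub_zero] at hlim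
    refine hlim.congr fun j => ?_
    rw [hux, hvx, ← sub_apply, Pi.neg_apply, BanachLattice.dualPosPart_sub_dualPosPart_neg]
    rfl
  tfae_finish
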